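/- Let $R$ be an associative unital ring (not necessarily commutative), let $G$ be a group, let $\phi\colon G\to\mathbb{Z}$ be an epimorphism, and let $K=\ker\phi$. For a group $\Gamma$ write $R\Gamma$ for its group ring, and let $H^i(\Gamma;R\Gamma)=\operatorname{Ext}^i_{R\Gamma}(R,R\Gamma)$, where $R$ is the trivial left $R\Gamma$-module and $R\Gamma$ is regarded as a left module over itself; right multiplication on the coefficients $R\Gamma$ makes $H^i(\Gamma;R\Gamma)$ a right $R\Gamma$-module. Let $n\in\mathbb{N}\cup\{\infty\}$ and suppose that $K$ is of type $\mathtt{FP}_n(R)$, that is, the trivial left $RK$-module $R$ has a resolution $\cdots\to P_1\to P_0\to R\to 0$ by projective left $RK$-modules with $P_i$ finitely generated for every $i\leqslant n$. Then, regarding $H^{j}(G;RG)$ as a right $RK$-module by restriction, \[ H^{i+1}(G;RG)\;\cong\; H^i(K;RK) \] as $RK$-modules for every $i<n$ and, if $n<\infty$, $H^n(K;RK)$ is isomorphic as an $RK$-module to a submodule of $H^{n+1}(G;RG)$. -/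

import Mathlib

open CategoryTheory

universe u v

noncomputable section

namespace GroupRingCohomology

/-- The augmentation `RG → R`, `∑ r_g g ↦ ∑ r_g`. The ring `R` need not be commutative. -/
def augmentation (R : Type u) [Ring R] (G : Type v) [Group G] : MonoidAlgebra R G →+* R :=
  MonoidAlgebra.liftNCRingHom (RingHom.id R) (1 : G →* R) (fun x _ => Commute.one_right x)

/-- The trivial left `RG`-module `R` (lifted to the universe of `RG`). -/
abbrev trivialModule (R : Type u) [Ring R] (G : Type v) [Group G] :
    ModuleCat.{max u v} (MonoidAlgebra R G) :=
  (ModuleCat.restrictScalars (augmentation R G)).obj (ModuleCat.of R (ULift.{v} R))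

/-- `G` is of type `FP_n(R)`, for `n ≤ ∞`: the trivial left `RG`-module `R` has a resolution by
projective left `RG`-modules that are finitely generated in all degrees `i ≤ n`. -/
def IsOfTypeFP (R : Type u) [Ring R] (G : Type v) [Group G] (n : ℕ∞) : Prop :=
  ∃ P : ProjectiveResolution (trivialModule R G),
    ∀ i : ℕ, (i : ℕ∞) ≤ n → Module.Finite (MonoidAlgebra R G) (P.complex.X i)

/-- The group cohomology `H^i(G; M) = Ext^i_{RG}(R, M)` with coefficients in a left `RG`-module. -/
abbrev cohomology (R : Type u) [Ring R] (G : Type v) [Group G]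
    (M : ModuleCat.{max u v} (MonoidAlgebra R G)) (i : ℕ) : Type (max u v) :=
  Abelian.Ext.{max u v} (trivialModule R G) M i

/-- `Ext^i(X, Y)` is functorial in `Y`, so the endomorphism ring of `Y` acts on it. -/
abbrev extModuleEnd {C : Type*} [Category C] [Abelian C] [HasExt.{u} C] (X Y : C) (i : ℕ) :
    Module (End Y) (Abelian.Ext.{u} X Y i) where
  smul f α := α.comp (Abelian.Ext.mk₀ f) (add_zero i)
  one_smul α := α.comp_mk₀_id
  mul_smul f g α := by
    change α.comp (Abelian.Ext.mk₀ (g ≫ f)) _ =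
      (α.comp (Abelian.Ext.mk₀ g) _).comp (Abelian.Ext.mk₀ f) _
    simp
  smul_zero f := Abelian.Ext.zero_comp _ _ _ _ _
  smul_add f α β := Abelian.Ext.add_comp _ _ _ _
  add_smul f g α := by
    change α.comp (Abelian.Ext.mk₀ (f + g)) _ =
      α.comp (Abelian.Ext.mk₀ f) _ + α.comp (Abelian.Ext.mk₀ g) _
    rw [Abelian.Ext.mk₀_add, Abelian.Ext.comp_add]
  zero_smul α := by
    change α.comp (Abelian.Ext.mk₀ 0) _ = 0
    rw [Abelian.Ext.mk₀_zero, Abelian.Ext.comp_zero]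

/-- Right multiplication: the ring homomorphism from `Sᵐᵒᵖ` to the endomorphism ring of the left
`S`-module `S` that sends `op s` to `x ↦ x * s`. -/
def rightMul (S : Type u) [Ring S] : Sᵐᵒᵖ →+* End (ModuleCat.of S S) :=
  ((ModuleCat.of S S).endRingEquiv.symm : _ →+* End (ModuleCat.of S S)).comp
    (Module.toModuleEnd S (S := Sᵐᵒᵖ) S)

/-- The right `RG`-module `H^i(G; RG)`: the left module structure of the bimodule `RG` is used to
form the cohomology, its right module structure induces the one on the cohomology. Right
`RG`-modules are modules over `(RG)ᵐᵒᵖ`. -/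
def cohomologyGroupRing (R : Type u) [Ring R] (G : Type v) [Group G] (i : ℕ) :
    ModuleCat.{max u v} (MonoidAlgebra R G)ᵐᵒᵖ :=
  letI : Module (MonoidAlgebra R G)ᵐᵒᵖ
      (cohomology R G (ModuleCat.of _ (MonoidAlgebra R G)) i) :=
    @Module.compHom _ _ _ _ _ (extModuleEnd _ _ i) _ (rightMul (MonoidAlgebra R G))
  ModuleCat.of _ (cohomology R G (ModuleCat.of _ (MonoidAlgebra R G)) i)

/-- The restriction of a right `RG`-module to a right `RK`-module, for a subgroup `K` of `G`. -/
abbrev restrictRight (R : Type u) [Ring R] {G : Type v} [Group G] (K : Subgroup G)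
    (M : ModuleCat.{max u v} (MonoidAlgebra R G)ᵐᵒᵖ) :
    ModuleCat.{max u v} (MonoidAlgebra R K)ᵐᵒᵖ :=
  (ModuleCat.restrictScalars (MonoidAlgebra.mapDomainRingHom R K.subtype).op).obj M

end GroupRingCohomology

end

/-! Choose `t` in `G` with `φ t = 1`. Then `S = RG` is a twisted Laurent polynomial ring over `A =
RK`: it is free as a left `A`-module on the powers of `t`, and `t` normalizes `A`. The operator `τ g
(s) = t⁻¹ g(t s)` on `Hom_A(S, S)` gives an exact sequence of `S`-modules `0 → S → Hom_A(S, S) →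
Hom_A(S, S) → 0` whose last map is `τ - 1` (`coindSeq_shortExact`).

By Shapiro's lemma (`extAdjunctionHom_bijective`), `Ext_S(R, Hom_A(S, S))` is `Ext_A(R, S)`, where
`S` is the direct sum of the `A tᵏ`. If the `i`-th term of the resolution is finitely generated,
each class of degree `i` has finitely many nonzero components (`exists_sum_extProj_eq`), and `τ`
shifts the components by one. Hence `τ - 1` is injective on `Ext^i`, and its cokernel is the
component `Ext^i_A(R, A)` at `k = 0`.

The connecting map of the long exact sequence, restricted to that component, is the required map
`wangHom`. Its injectivity in degree `i` needs only the `i`-th term to be finitely generated;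
surjectivity also uses the injectivity of `τ - 1` on `Ext^(i+1)`, hence the next term. This is the
difference between `i < n` and `i = n`. -/

noncomputable section

namespace GroupRingCohomology

/-! ### Shapiro's lemma for Ext along an exact left adjoint -/

section Shapiro

universe w w' u₁ v₁ u₂ v₂

open Abelian

variable {C : Type u₁} [Category.{v₁} C] [Abelian C] [HasExt.{w} C]
  {D : Type u₂} [Category.{v₂} D] [Abelian D] [HasExt.{w'} D]
  {L : C ⥤ D} {F : D ⥤ C} [L.Additive] [Limits.PreservesFiniteLimits L]
  [Limits.PreservesFiniteColimits L]

/-- The map `Ext(X, F Y) → Ext(L X, Y)` induced by an exact functor `L` left adjoint to `F`. -/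
def extAdjunctionHom (adj : L ⊣ F) (X : C) (Y : D) (n : ℕ) :
    Ext.{w} X (F.obj Y) n →+ Ext.{w'} (L.obj X) Y n where
  toFun x := (x.mapExactFunctor L).comp (Ext.mk₀ (adj.counit.app Y)) (add_zero n)
  map_zero' := by simp
  map_add' x y := by simp

lemma extAdjunctionHom_apply (adj : L ⊣ F) {X : C} {Y : D} {n : ℕ} (x : Ext X (F.obj Y) n) :
    extAdjunctionHom adj X Y n x =
      (x.mapExactFunctor L).comp (Ext.mk₀ (adj.counit.app Y)) (add_zero n) := rfl

lemma extAdjunctionHom_comp_mk₀_map (adj : L ⊣ F) {X : C} {Y Y' : D} {n : ℕ}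
    (x : Ext.{w} X (F.obj Y) n) (g : Y ⟶ Y') :
    extAdjunctionHom.{w, w'} adj X Y' n (x.comp (Ext.mk₀ (F.map g)) (add_zero n)) =
      (extAdjunctionHom adj X Y n x).comp (Ext.mk₀ g) (add_zero n) := by
  simp only [extAdjunctionHom_apply, Ext.mapExactFunctor_comp, Ext.mapExactFunctor_mk₀,
    Ext.comp_assoc_of_third_deg_zero, Ext.mk₀_comp_mk₀]
  congr 2
  exact adj.counit.naturality g

lemma extAdjunctionHom_comp (adj : L ⊣ F) {X X' : C} {Y : D} {m n k : ℕ}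
    (a : Ext.{w} X X' m) (x : Ext.{w} X' (F.obj Y) n) (h : m + n = k) :
    extAdjunctionHom.{w, w'} adj X Y k (a.comp x h) =
      (a.mapExactFunctor L).comp (extAdjunctionHom adj X' Y n x) h := by
  simp only [extAdjunctionHom_apply, Ext.mapExactFunctor_comp, Ext.comp_assoc_of_third_deg_zero]

lemma extAdjunctionHom_mk₀ (adj : L ⊣ F) {X : C} {Y : D} (f : X ⟶ F.obj Y) :
    extAdjunctionHom.{w, w'} adj X Y 0 (Ext.mk₀ f) = Ext.mk₀ ((adj.homEquiv X Y).symm f) := by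
  simp [extAdjunctionHom_apply, Ext.mapExactFunctor_mk₀, Adjunction.homEquiv_counit]

/-- An adjunction between an exact functor `L` preserving projective objects and a functor `F`
induces isomorphisms `Ext(X, F Y) ≅ Ext(L X, Y)`. -/
lemma extAdjunctionHom_bijective [EnoughProjectives C] [L.PreservesProjectiveObjects]
    (adj : L ⊣ F) (X : C) (Y : D) (n : ℕ) :
    Function.Bijective (extAdjunctionHom.{w, w'} adj X Y n) := by
  induction n generalizing X with
  | zero =>
    have h : extAdjunctionHom.{w, w'} adj X Y 0 ∘ (Ext.homEquiv₀ (X := X) (Y := F.obj Y)).symm =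
        (Ext.homEquiv₀ (X := L.obj X) (Y := Y)).symm ∘ (adj.homEquiv X Y).symm :=
      funext fun f => extAdjunctionHom_mk₀ adj f
    rw [← Function.Bijective.of_comp_iff _ (Ext.homEquiv₀ (X := X) (Y := F.obj Y)).symm.bijective, h]
    exact (Equiv.bijective _).comp (Equiv.bijective _)
  | succ n ih =>
    -- Dimension shifting: the middle term is projective and stays so under `L`, so both groups
    -- `Ext^(n+1)` are quotients of `Ext^n` of the kernel.
    let T : ShortComplex C := ShortComplex.mk (Limits.kernel.ι (Projective.π X)) (Projective.π X)
      (by simp)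
    have hT : T.ShortExact :=
      { exact := ShortComplex.exact_of_f_is_kernel _ (Limits.kernelIsKernel _) }
    have hLT := hT.map_of_exact L
    have : Projective T.X₂ := Projective.projective_over X
    have : Projective (T.map L).X₂ :=
      Functor.PreservesProjectiveObjects.projective_obj (F := L) this
    constructor
    · rw [injective_iff_map_eq_zero]
      intro x hx
      obtain ⟨y, rfl⟩ := Ext.contravariant_sequence_exact₃ hT (F.obj Y) x
        (Ext.eq_zero_of_projective _) (add_comm 1 n)
      rw [extAdjunctionHom_comp, Ext.mapExactFunctor_extClass] at hx
      obtain ⟨z, hz⟩ := Ext.contravariant_sequence_exact₁ hLT Y _ (add_comm 1 n) hx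
      -- The induction hypothesis is needed at the projective term too, since its `Ext^n` need not
      -- vanish when `n = 0`.
      obtain ⟨z, rfl⟩ := (ih T.X₂).2 z
      have : (Ext.mk₀ T.f).comp z (zero_add n) = y := by
        apply (ih T.X₁).1
        rw [extAdjunctionHom_comp, Ext.mapExactFunctor_mk₀]
        exact hz
      rw [← this, hT.extClass_comp_assoc]
    · intro w
      obtain ⟨y, rfl⟩ := Ext.contravariant_sequence_exact₃ hLT Y w
        (Ext.eq_zero_of_projective _) (add_comm 1 n)
      obtain ⟨y, rfl⟩ := (ih T.X₁).2 y
      refine ⟨hT.extClass.comp y (add_comm 1 n), ?_⟩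
      rw [extAdjunctionHom_comp, Ext.mapExactFunctor_extClass]
      rfl

end Shapiro

/-! ### Shift operators on graded groups -/

section Shift

variable {E : Type*} [AddCommGroup E] {π : ℤ → E →+ E} {τ : E ≃+ E}

/-- If `τ` shifts the grading given by the projections `π k`, and if `τ e - e` is homogeneous of
degree `0`, then `e = 0`. -/
lemma eq_zero_of_shift_sub_homogeneous
    (hπ : ∀ k l e, k ≠ l → π k (π l e) = 0) (hτ : ∀ k e, π k (τ e) = τ (π (k + 1) e))
    {e : E} (s : Finset ℤ) (hs : ∑ k ∈ s, π k e = e)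
    (h : ∀ k, k ≠ 0 → π k (τ e - e) = 0) : e = 0 := by
  have h0 : ∀ k, k ∉ s → π k e = 0 := fun k hk => by
    rw [← hs, map_sum]
    exact Finset.sum_eq_zero fun l hl => hπ k l e fun h => hk (h ▸ hl)
  -- Vanishing passes between neighbouring degrees except between `0` and `1`. The degrees `≥ 1` and
  -- the degrees `≤ 0` thus form two chains, each ending outside the finite support.
  have h1 : ∀ k, k ≠ 0 → (π k e = 0 ↔ π (k + 1) e = 0) := fun k hk => by
    have := h k hk
    rw [map_sub, hτ, sub_eq_zero] at this
    rw [← this, EmbeddingLike.map_eq_zero_iff]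
  obtain ⟨b, hb⟩ := s.bddAbove
  obtain ⟨a, ha⟩ := s.bddBelow
  have hpos : ∀ m : ℕ, ∀ k : ℤ, 1 ≤ k → b < k + m → π k e = 0 := by
    intro m
    induction m with
    | zero => exact fun k _ hk => h0 k fun hks => by have := hb hks; simp at hk; omega
    | succ m ih =>
      exact fun k hk hkm => (h1 k (by omega)).2 (ih (k + 1) (by omega) (by push_cast at hkm; omega))
  have hneg : ∀ m : ℕ, ∀ k : ℤ, k ≤ 0 → k - m < a → π k e = 0 := by
    intro m
    induction m with
    | zero => exact fun k _ hk => h0 k fun hks => by have := ha hks; simp at hk; omega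
    | succ m ih =>
      intro k hk hkm
      have := (h1 (k - 1) (by omega)).1 (ih (k - 1) (by omega) (by push_cast at hkm; omega))
      rwa [sub_add_cancel] at this
  rw [← hs]
  refine Finset.sum_eq_zero fun k _ => ?_
  rcases le_or_gt k 0 with hk | hk
  · exact hneg (k - a + 1).toNat k hk (by omega)
  · exact hpos (b - k + 1).toNat k hk (by omega)

/-- If a map `δ` is invariant under `τ`, which shifts the grading, then the value of `δ` at a
homogeneous element is also its value at an element of degree `0`. -/
lemma exists_degree_zero_of_homogeneous {B : Type*} (hτ : ∀ k e, π k (τ e) = τ (π (k + 1) e))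
    (δ : E → B) (hδ : ∀ e, δ (τ e) = δ e) (k : ℤ) :
    ∀ e, π k e = e → ∃ e', π 0 e' = e' ∧ δ e' = δ e := by
  induction k with
  | zero => exact fun e he => ⟨e, he, rfl⟩
  | succ k ih =>
    intro e he
    obtain ⟨e', h, h'⟩ := ih (τ e) (by rw [hτ, he])
    exact ⟨e', h, h'.trans (hδ e)⟩
  | pred k ih =>
    intro e he
    obtain ⟨e', h, h'⟩ := ih (τ.symm e) <| by
      apply τ.injective
      have := hτ (-k - 1) (τ.symm e)
      rwa [sub_add_cancel, τ.apply_symm_apply, he, eq_comm, ← τ.apply_symm_apply e,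
        τ.symm_apply_apply] at this
    exact ⟨e', h, h'.trans (by rw [← hδ, τ.apply_symm_apply])⟩

/-- Every integer-indexed sequence of an additive group is the sequence of differences of
another one. -/
lemma exists_int_antidifference (d : ℤ → E) : ∃ w : ℤ → E, ∀ j, w (j + 1) - w j = d j := by
  -- The sum of `d` over `[0, j)`, or minus its sum over `[j, 0)` if `j < 0`; `toNat` makes the
  -- irrelevant sum empty.
  refine ⟨fun j => ∑ i ∈ Finset.range j.toNat, d i - ∑ i ∈ Finset.range (-j).toNat, d (-(i + 1)),
    fun j => ?_⟩
  obtain ⟨n, rfl | rfl⟩ : ∃ n : ℕ, j = n ∨ j = -(n + 1) := by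
    rcases le_or_gt 0 j with h | h
    · exact ⟨j.toNat, Or.inl (by omega)⟩
    · exact ⟨(-j - 1).toNat, Or.inr (by omega)⟩
  · have h1 : ((n : ℤ) + 1).toNat = n + 1 := by omega
    have h2 : (-1 + -(n : ℤ)).toNat = 0 := by omega
    simp [h1, h2, Finset.sum_range_succ]
  · have h1 : ((n : ℤ) + 1).toNat = n + 1 := by omega
    have h2 : (-1 + -(n : ℤ)).toNat = 0 := by omega
    simp [h1, h2, Finset.sum_range_succ]

end Shift

/-! ### Twisted Laurent polynomial rings and the coinduced sequence -/

section Laurent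

open Abelian

universe w

/-- The ring `S` as a left module over `A`. -/
abbrev resRing {A S : Type w} [Ring A] [Ring S] (f : A →+* S) : ModuleCat.{w} A :=
  (ModuleCat.restrictScalars f).obj (ModuleCat.of S S)

/-- The data exhibiting a ring `S` over `f : A →+* S` as a twisted Laurent polynomial ring
`A[t, t⁻¹; σ]`: the powers of the unit `t` form a basis of the left `A`-module `S`, and
`t a = σ(a) t`. -/
structure LaurentBasis {A S : Type w} [Ring A] [Ring S] (f : A →+* S) where
  /-- the variable -/
  t : Sˣ
  /-- the twist -/
  σ : A ≃+* A
  t_mul : ∀ a, (t : S) * f a = f (σ a) * t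
  /-- the basis of the powers of `t` -/
  basis : Module.Basis ℤ A (resRing f)
  basis_apply : ∀ j, basis j = ((t ^ j : Sˣ) : S)

variable {A S : Type w} [Ring A] [Ring S] {f : A →+* S} (β : LaurentBasis f)

namespace LaurentBasis

lemma t_inv_mul (a : A) : ((β.t⁻¹ : Sˣ) : S) * f a = f (β.σ.symm a) * ((β.t⁻¹ : Sˣ) : S) := by
  rw [Units.inv_mul_eq_iff_eq_mul, ← mul_assoc, β.t_mul, RingEquiv.apply_symm_apply,
    Units.mul_inv_cancel_right]

end LaurentBasis

/-- The coinduced module `Hom_A(S, Y)`. -/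
abbrev coind (f : A →+* S) (Y : ModuleCat.{w} S) : ModuleCat.{w} S :=
  (ModuleCat.coextendScalars f).obj ((ModuleCat.restrictScalars f).obj Y)

namespace coind

variable {Y Z : ModuleCat.{w} S}

/-- The value of an element of the coinduced module. -/
def eval (g : coind f Y) (s : S) : Y :=
  ModuleCat.CoextendScalars.equiv f _ g s

/-- The constructor for elements of the coinduced module. -/
def mk (f : A →+* S) (g : S → Y) (hadd : ∀ s s', g (s + s') = g s + g s')
    (hsmul : ∀ a s, g (f a * s) = f a • g s) : coind f Y :=
  (ModuleCat.CoextendScalars.equiv f _).symm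
    { toFun := g
      map_add' := hadd
      map_smul' := hsmul }

@[simp]
lemma eval_mk (g : S → Y) (hadd : ∀ s s', g (s + s') = g s + g s')
    (hsmul : ∀ a s, g (f a * s) = f a • g s) (s : S) : eval (mk f g hadd hsmul) s = g s := rfl

lemma eval_ext {g h : coind f Y} (H : ∀ s, coind.eval g s = coind.eval h s) : g = h :=
  (ModuleCat.CoextendScalars.equiv f _).injective (LinearMap.ext H)

lemma eval_map_add (g : coind f Y) (s s' : S) : coind.eval g (s + s') = coind.eval g s + coind.eval g s' :=
  map_add (ModuleCat.CoextendScalars.equiv f _ g) _ _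

lemma eval_map_mul (g : coind f Y) (a : A) (s : S) : coind.eval g (f a * s) = f a • coind.eval g s :=
  map_smul (ModuleCat.CoextendScalars.equiv f _ g) _ _

@[simp]
lemma add_eval (g h : coind f Y) (s : S) : coind.eval (g + h) s = coind.eval g s + coind.eval h s := rfl

@[simp]
lemma sub_eval (g h : coind f Y) (s : S) : coind.eval (g - h) s = coind.eval g s - coind.eval h s := rfl

/-- The endomorphism `g ↦ (s ↦ u⁻¹ g(u s))` of a coinduced module, where `u` is a unit normalizing
the subring. -/
def conj (Y : ModuleCat.{w} S) (u : Sˣ) (ρ : A →+* A)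
    (h : ∀ a, (u : S) * f a = f (ρ a) * u) : coind f Y ⟶ coind f Y :=
  ModuleCat.ofHom (X := coind f Y) (Y := coind f Y)
    { toFun := fun g => coind.mk f (fun s : S => ((u⁻¹ : Sˣ) : S) • coind.eval g ((u : S) * s))
        (fun s s' => by rw [mul_add, eval_map_add, smul_add])
        (fun a s => by
          rw [← mul_assoc, h, mul_assoc, eval_map_mul, smul_smul, smul_smul]
          congr 1
          rw [Units.inv_mul_eq_iff_eq_mul, ← mul_assoc, h, Units.mul_inv_cancel_right])
      map_add' := fun g h => eval_ext fun s => by simp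
      map_smul' := fun r g => eval_ext fun s => by
        change ((u⁻¹ : Sˣ) : S) • eval g (u * s * r) = ((u⁻¹ : Sˣ) : S) • eval g (u * (s * r))
        rw [mul_assoc] }

/-- The inclusion `y ↦ (s ↦ s y)` of a module into the coinduced module. -/
def unit (f : A →+* S) (Y : ModuleCat.{w} S) : Y ⟶ coind f Y :=
  ModuleCat.ofHom (Y := coind f Y)
    { toFun := fun y => coind.mk f (fun s : S => s • y) (fun s s' => add_smul s s' y)
        (fun a s => mul_smul _ _ _)
      map_add' := fun y z => eval_ext fun s => by simp
      map_smul' := fun r y => eval_ext fun s => (mul_smul s r y).symm }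

@[simp]
lemma unit_eval (y : Y) (s : S) : coind.eval (unit f Y y) s = s • y := rfl

end coind

namespace LaurentBasis

/-- The automorphism `g ↦ (s ↦ t⁻¹ g(t s))` of the coinduced module. -/
def shift (Y : ModuleCat.{w} S) : coind f Y ≅ coind f Y where
  hom := coind.conj Y β.t β.σ β.t_mul
  inv := coind.conj Y β.t⁻¹ β.σ.symm β.t_inv_mul
  hom_inv_id := by
    refine ModuleCat.hom_ext <| LinearMap.ext fun g => coind.eval_ext fun s => ?_
    change ((β.t⁻¹⁻¹ : Sˣ) : S) • ((β.t⁻¹ : Sˣ) : S) •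
      coind.eval g ((β.t : S) * (((β.t⁻¹ : Sˣ) : S) * s)) = coind.eval g s
    simp [smul_smul]
  inv_hom_id := by
    refine ModuleCat.hom_ext <| LinearMap.ext fun g => coind.eval_ext fun s => ?_
    change ((β.t⁻¹ : Sˣ) : S) • ((β.t⁻¹⁻¹ : Sˣ) : S) •
      coind.eval g (((β.t⁻¹ : Sˣ) : S) * ((β.t : S) * s)) = coind.eval g s
    simp [smul_smul]

lemma shift_hom_eval {Y : ModuleCat.{w} S} (g : coind f Y) (s : S) :
    coind.eval ((β.shift Y).hom g) s = ((β.t⁻¹ : Sˣ) : S) • coind.eval g ((β.t : S) * s) := rfl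

lemma eq_sum (s : S) :
    s = (β.basis.repr s).sum fun j a => f a * ((β.t ^ j : Sˣ) : S) := by
  conv_lhs => rw [← β.basis.linearCombination_repr s]
  rw [Finsupp.linearCombination_apply]
  refine Finsupp.sum_congr fun j _ => ?_
  rw [β.basis_apply]
  rfl

@[elab_as_elim]
lemma induction {p : S → Prop} (s : S) (h : ∀ a (j : ℤ), p (f a * ((β.t ^ j : Sˣ) : S)))
    (hadd : ∀ s s', p s → p s' → p (s + s')) : p s := by
  rw [β.eq_sum s]
  refine Finset.sum_induction _ p hadd ?_ fun j _ => h _ _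
  simpa using h 0 0

lemma coind_ext {Y : ModuleCat.{w} S} {g h : coind f Y}
    (H : ∀ j : ℤ, coind.eval g ((β.t ^ j : Sˣ) : S) = coind.eval h ((β.t ^ j : Sˣ) : S)) :
    g = h := by
  refine coind.eval_ext fun s => ?_
  induction s using β.induction with
  | h a j => rw [coind.eval_map_mul, coind.eval_map_mul, H]
  | hadd s s' hs hs' => rw [coind.eval_map_add, coind.eval_map_add, hs, hs']

/-- A fixed point satisfies `g(t s) = t g(s)`. Together with `A`-linearity this makes `g` linear
over `S`, so `g` is determined by `y = g(1)`. -/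
lemma exists_unit_eq_of_shift_eq {Y : ModuleCat.{w} S} {g : coind f Y}
    (hg : (β.shift Y).hom g = g) : ∃ y, coind.unit f Y y = g := by
  have h : ∀ s, coind.eval g ((β.t : S) * s) = (β.t : S) • coind.eval g s := fun s => by
    conv_rhs => rw [← hg, shift_hom_eval, smul_smul, Units.mul_inv, one_smul]
  refine ⟨coind.eval g 1, β.coind_ext fun j => ?_⟩
  rw [coind.unit_eval]
  induction j with
  | zero => simp
  | succ j ih => rw [add_comm, zpow_add, Units.val_mul, zpow_one, h, mul_smul, ih]
  | pred j ih =>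
    rw [← sub_add_cancel (-(j : ℤ)) 1, add_comm, zpow_add, Units.val_mul, zpow_one, h,
      mul_smul] at ih
    have := congrArg (((β.t⁻¹ : Sˣ) : S) • ·) ih
    simpa only [smul_smul, Units.inv_mul, Units.inv_mul_cancel_left, one_smul] using this

lemma exists_shift_sub_eq {Y : ModuleCat.{w} S} (h : coind f Y) :
    ∃ g : coind f Y, (β.shift Y).hom g - g = h := by
  -- The values of `g` on the basis `tʲ` are free to choose. With `g(tʲ) = tʲ w_j` the equation
  -- becomes `w_(j+1) - w_j = t⁻ʲ h(tʲ)`.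
  obtain ⟨w, hw⟩ := exists_int_antidifference
    fun j : ℤ => ((β.t ^ (-j) : Sˣ) : S) • coind.eval h ((β.t ^ j : Sˣ) : S)
  let l := β.basis.constr ℕ (M' := (ModuleCat.restrictScalars f).obj Y)
    fun j => (((β.t ^ j : Sˣ) : S) • w j : Y)
  let g : coind f Y := (ModuleCat.CoextendScalars.equiv f _).symm l
  have hg : ∀ j : ℤ, coind.eval g ((β.t ^ j : Sˣ) : S) = ((β.t ^ j : Sˣ) : S) • w j := fun j =>
    (congrArg l (β.basis_apply j).symm).trans (β.basis.constr_basis ..)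
  refine ⟨g, β.coind_ext fun j => ?_⟩
  have h1 : (β.t : S) * ((β.t ^ j : Sˣ) : S) = ((β.t ^ (j + 1) : Sˣ) : S) := by
    rw [← Units.val_mul, add_comm, zpow_add, zpow_one]
  have h2 : ((β.t⁻¹ : Sˣ) : S) * ((β.t ^ (j + 1) : Sˣ) : S) = ((β.t ^ j : Sˣ) : S) := by
    rw [← h1, Units.inv_mul_cancel_left]
  rw [coind.sub_eval, shift_hom_eval, h1, hg, hg, smul_smul, h2, ← smul_sub, hw, smul_smul,
    ← Units.val_mul, ← zpow_add, add_neg_cancel, zpow_zero, Units.val_one, one_smul]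

lemma unit_shift (Y : ModuleCat.{w} S) :
    coind.unit f Y ≫ (β.shift Y).hom = coind.unit f Y := by
  refine ModuleCat.hom_ext <| LinearMap.ext fun y => coind.eval_ext fun s => ?_
  change ((β.t⁻¹ : Sˣ) : S) • ((β.t : S) * s) • y = s • y
  simp [smul_smul]

/-- The sequence `0 → Y → Hom_A(S, Y) → Hom_A(S, Y) → 0`. -/
abbrev coindSeq (Y : ModuleCat.{w} S) : ShortComplex (ModuleCat.{w} S) :=
  ShortComplex.mk (coind.unit f Y) ((β.shift Y).hom - 𝟙 _) <| by
    rw [Preadditive.comp_sub, unit_shift, Category.comp_id, sub_self]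

lemma coindSeq_shortExact (Y : ModuleCat.{w} S) : (β.coindSeq Y).ShortExact where
  mono_f := by
    rw [ModuleCat.mono_iff_injective]
    intro y z h
    have := congrArg (fun g : coind f Y => coind.eval g 1) h
    change (1 : S) • y = (1 : S) • z at this
    simpa using this
  epi_g := by
    rw [ModuleCat.epi_iff_surjective]
    exact fun h => β.exists_shift_sub_eq (Y := Y) h
  exact := by
    rw [ShortComplex.moduleCat_exact_iff]
    exact fun g hg => β.exists_unit_eq_of_shift_eq (Y := Y) (sub_eq_zero.1 hg)

/-- The morphism between the sequences `coindSeq` induced by a morphism of modules. -/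
def coindSeqMap {Y Z : ModuleCat.{w} S} (l : Y ⟶ Z) : β.coindSeq Y ⟶ β.coindSeq Z where
  τ₁ := l
  τ₂ := (ModuleCat.coextendScalars f).map ((ModuleCat.restrictScalars f).map l)
  τ₃ := (ModuleCat.coextendScalars f).map ((ModuleCat.restrictScalars f).map l)
  comm₁₂ := ModuleCat.hom_ext <| LinearMap.ext fun y => coind.eval_ext fun s =>
    (map_smul l.hom s y).symm
  comm₂₃ := ModuleCat.hom_ext <| LinearMap.ext fun g => coind.eval_ext fun s => by
    change ((β.t⁻¹ : Sˣ) : S) • l.hom (coind.eval (Y := Y) g (β.t * s)) -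
        l.hom (coind.eval (Y := Y) g s) =
      l.hom (((β.t⁻¹ : Sˣ) : S) • coind.eval (Y := Y) g (β.t * s) - coind.eval (Y := Y) g s)
    rw [map_sub, map_smul]

/-- The `k`-th coordinate `S → A`. -/
def coord (k : ℤ) : resRing f ⟶ ModuleCat.of A A :=
  ModuleCat.ofHom (X := resRing f) (β.basis.coord k)

/-- The map `A → S`, `a ↦ a tᵏ`. -/
def incl (k : ℤ) : ModuleCat.of A A ⟶ resRing f :=
  ModuleCat.ofHom (Y := resRing f) (LinearMap.toSpanSingleton A _ (β.basis k))

lemma incl_apply (k : ℤ) (a : A) : (β.incl k a : S) = f a * ((β.t ^ k : Sˣ) : S) := by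
  rw [← β.basis_apply]
  rfl

lemma incl_coord (k l : ℤ) : β.incl k ≫ β.coord l = if k = l then 𝟙 _ else 0 := by
  refine ModuleCat.hom_ext <| LinearMap.ext fun a => ?_
  change β.basis.repr (a • β.basis k) l = _
  rw [map_smul, Module.Basis.repr_self, Finsupp.smul_single, Finsupp.single_apply, smul_eq_mul,
    mul_one]
  split_ifs <;> rfl

/-- The projection of `S` onto `A tᵏ`. -/
def proj (k : ℤ) : resRing f ⟶ resRing f := β.coord k ≫ β.incl k

lemma proj_comp_proj_of_ne {k l : ℤ} (h : k ≠ l) : β.proj k ≫ β.proj l = 0 := by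
  simp [proj, reassoc_of% (β.incl_coord k l), h]

lemma incl_proj (k : ℤ) : β.incl k ≫ β.proj k = β.incl k := by
  simp [proj, reassoc_of% (β.incl_coord k k)]

lemma proj_comp_proj_self (k : ℤ) : β.proj k ≫ β.proj k = β.proj k := by
  rw [proj, Category.assoc, ← proj, incl_proj, proj]

/-- The projection of `S` onto `A tᵏ` as an additive map. -/
def projAddHom (k : ℤ) : S →+ S := (β.proj k).hom.toAddMonoidHom

lemma projAddHom_mul_zpow (k j : ℤ) (a : A) :
    β.projAddHom k (f a * ((β.t ^ j : Sˣ) : S)) =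
      if j = k then f a * ((β.t ^ j : Sˣ) : S) else 0 := by
  have h : β.projAddHom k (f a * ((β.t ^ j : Sˣ) : S)) = ((β.incl j ≫ β.coord k) ≫ β.incl k) a := by
    rw [← incl_apply]
    rfl
  rw [h, incl_coord]
  split_ifs
  · subst_vars
    rw [Category.id_comp, incl_apply]
  · rw [Limits.zero_comp]
    rfl

/-- Since `t⁻¹ a = σ⁻¹(a) t⁻¹`, left multiplication by `t⁻¹` lowers the degree in `t` by one. -/
lemma projAddHom_t_inv_mul (k : ℤ) (s : S) :
    β.projAddHom k (((β.t⁻¹ : Sˣ) : S) * s) = ((β.t⁻¹ : Sˣ) : S) * β.projAddHom (k + 1) s := by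
  induction s using β.induction with
  | h a j =>
    have : ((β.t⁻¹ : Sˣ) : S) * (f a * ((β.t ^ j : Sˣ) : S)) =
        f (β.σ.symm a) * ((β.t ^ (j - 1) : Sˣ) : S) := by
      rw [← mul_assoc, t_inv_mul, mul_assoc, ← Units.val_mul, ← zpow_neg_one, ← zpow_add,
        neg_add_eq_sub]
    rw [this, projAddHom_mul_zpow, projAddHom_mul_zpow, ← this, mul_ite, mul_zero]
    simp only [sub_eq_iff_eq_add]
  | hadd s s' hs hs' => rw [mul_add, map_add, map_add, mul_add, ← hs, ← hs']

lemma coind_proj_shift (k : ℤ) :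
    (β.shift (ModuleCat.of S S)).hom ≫ (ModuleCat.coextendScalars f).map (β.proj k) =
      (ModuleCat.coextendScalars f).map (β.proj (k + 1)) ≫ (β.shift (ModuleCat.of S S)).hom :=
  ModuleCat.hom_ext <| LinearMap.ext fun _ => coind.eval_ext fun _ => β.projAddHom_t_inv_mul k _

/-- The images of finitely many generators involve finitely many powers of `t`. Finite generation of
the resolution enters the proof only here. -/
lemma exists_comp_sum_proj {P : ModuleCat.{w} A} [Module.Finite A P]
    (g : P ⟶ resRing f) :
    ∃ s : Finset ℤ, g ≫ ∑ k ∈ s, β.proj k = g := by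
  obtain ⟨T, hT⟩ := Module.Finite.fg_top (R := A) (M := P)
  refine ⟨T.biUnion fun x => (β.basis.repr (g x)).support,
    ModuleCat.hom_ext <| LinearMap.ext_on hT fun x hx => ?_⟩
  rw [Preadditive.comp_sum, ModuleCat.hom_sum, LinearMap.sum_apply]
  change ∑ k ∈ _, β.basis.repr (g x) k • β.basis k = g x
  conv_rhs => rw [← β.basis.linearCombination_repr (g x), Finsupp.linearCombination_apply]
  symm
  refine Finset.sum_subset (Finset.subset_biUnion_of_mem
    (fun x => (β.basis.repr (g x)).support) hx) fun k _ hk => ?_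
  rw [Finsupp.notMem_support_iff.1 hk]
  exact zero_smul _ _

end LaurentBasis

instance (f : A →+* S) : Limits.PreservesFiniteLimits (ModuleCat.restrictScalars.{w} f) :=
  ⟨fun _ => ⟨fun {_} => inferInstance⟩⟩

/-- As `S` is free over `A`, the right adjoint `Hom_A(S, -)` of restriction preserves epimorphisms.
-/
lemma LaurentBasis.preservesProjectiveObjects (β : LaurentBasis f) :
    (ModuleCat.restrictScalars.{w} f).PreservesProjectiveObjects := by
  have := Module.Projective.of_basis β.basis
  have : (ModuleCat.coextendScalars.{w, w, w} f).PreservesEpimorphisms := ⟨fun l hl => by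
    rw [ModuleCat.epi_iff_surjective] at hl ⊢
    intro g
    obtain ⟨h, hh⟩ := Module.projective_lifting_property l.hom
      (ModuleCat.CoextendScalars.equiv f _ g) hl
    exact ⟨(ModuleCat.CoextendScalars.equiv f _).symm h, hh⟩⟩
  exact Functor.preservesProjectiveObjects_of_adjunction_of_preservesEpimorphisms
    (ModuleCat.restrictCoextendScalarsAdj f)

end Laurent

/-! ### The connecting map and its bijectivity -/

section Wang

open Abelian

universe w

lemma ext_comp_mk₀_sum {C : Type*} [Category C] [Abelian C] [HasExt.{w} C] {X Y Z : C} {n : ℕ}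
    (x : Ext.{w} X Y n) {ι : Type*} (s : Finset ι) (g : ι → (Y ⟶ Z)) :
    x.comp (Ext.mk₀ (∑ i ∈ s, g i)) (add_zero n) =
      ∑ i ∈ s, x.comp (Ext.mk₀ (g i)) (add_zero n) := by
  classical
  induction s using Finset.induction_on with
  | empty => simp
  | insert i s hi ih => rw [Finset.sum_insert hi, Finset.sum_insert hi, Ext.mk₀_add, Ext.comp_add, ih]

variable {A S : Type w} [Ring A] [Ring S] {f : A →+* S} (β : LaurentBasis f)

namespace LaurentBasis

/-- The isomorphism `Ext_S(X, Hom_A(S, Y)) ≅ Ext_A(X, Y)`. -/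
def extCoextendEquiv (X : ModuleCat.{w} S) (Y : ModuleCat.{w} A) (n : ℕ) :
    Ext.{w} X ((ModuleCat.coextendScalars f).obj Y) n ≃+
      Ext.{w} ((ModuleCat.restrictScalars f).obj X) Y n :=
  haveI := β.preservesProjectiveObjects
  AddEquiv.ofBijective _
    (extAdjunctionHom_bijective (ModuleCat.restrictCoextendScalarsAdj.{w, w, w} f) X Y n)

lemma extCoextendEquiv_comp {X : ModuleCat.{w} S} {Y Z : ModuleCat.{w} A} {n : ℕ}
    (x : Ext.{w} X ((ModuleCat.coextendScalars f).obj Y) n) (g : Y ⟶ Z) :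
    β.extCoextendEquiv X Z n
        (x.comp (Ext.mk₀ ((ModuleCat.coextendScalars f).map g)) (add_zero n)) =
      (β.extCoextendEquiv X Y n x).comp (Ext.mk₀ g) (add_zero n) :=
  extAdjunctionHom_comp_mk₀_map _ x g

lemma extCoextendEquiv_symm_comp {X : ModuleCat.{w} S} {Y Z : ModuleCat.{w} A} {n : ℕ}
    (x : Ext.{w} ((ModuleCat.restrictScalars f).obj X) Y n) (g : Y ⟶ Z) :
    (β.extCoextendEquiv X Z n).symm (x.comp (Ext.mk₀ g) (add_zero n)) =
      ((β.extCoextendEquiv X Y n).symm x).comp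
        (Ext.mk₀ ((ModuleCat.coextendScalars f).map g)) (add_zero n) := by
  rw [AddEquiv.symm_apply_eq, extCoextendEquiv_comp, AddEquiv.apply_symm_apply]

variable (X : ModuleCat.{w} S) (n : ℕ)

/-- The projections on `Ext_S(X, Hom_A(S, S))` induced by those of `S` onto `A tᵏ`. -/
def extProj (k : ℤ) : Ext.{w} X (coind f (ModuleCat.of S S)) n →+
    Ext.{w} X (coind f (ModuleCat.of S S)) n :=
  (Ext.mk₀ ((ModuleCat.coextendScalars f).map (β.proj k))).postcomp X (add_zero n)

/-- The automorphism of `Ext_S(X, Hom_A(S, S))` induced by `shift`. -/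
def extShift : Ext.{w} X (coind f (ModuleCat.of S S)) n ≃+
    Ext.{w} X (coind f (ModuleCat.of S S)) n where
  toFun x := x.comp (Ext.mk₀ (β.shift (ModuleCat.of S S)).hom) (add_zero n)
  invFun x := x.comp (Ext.mk₀ (β.shift (ModuleCat.of S S)).inv) (add_zero n)
  left_inv x := by simp
  right_inv x := by simp
  map_add' x y := by simp

variable {X n}

lemma extProj_apply (k : ℤ) (x : Ext.{w} X (coind f (ModuleCat.of S S)) n) :
    β.extProj X n k x =
      x.comp (Ext.mk₀ ((ModuleCat.coextendScalars f).map (β.proj k))) (add_zero n) := rfl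

lemma extShift_apply (x : Ext.{w} X (coind f (ModuleCat.of S S)) n) :
    β.extShift X n x = x.comp (Ext.mk₀ (β.shift (ModuleCat.of S S)).hom) (add_zero n) := rfl

lemma extCoextendEquiv_extProj (k : ℤ) (x : Ext.{w} X (coind f (ModuleCat.of S S)) n) :
    β.extCoextendEquiv X (resRing f) n (β.extProj X n k x) =
      (β.extCoextendEquiv X (resRing f) n x).comp (Ext.mk₀ (β.proj k)) (add_zero n) :=
  β.extCoextendEquiv_comp x _

lemma extProj_extProj_of_ne {k l : ℤ} (h : k ≠ l)
    (x : Ext.{w} X (coind f (ModuleCat.of S S)) n) :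
    β.extProj X n k (β.extProj X n l x) = 0 := by
  apply (β.extCoextendEquiv X (resRing f) n).injective
  simp [extCoextendEquiv_extProj, β.proj_comp_proj_of_ne h.symm]

lemma extProj_extProj_self (k : ℤ) (x : Ext.{w} X (coind f (ModuleCat.of S S)) n) :
    β.extProj X n k (β.extProj X n k x) = β.extProj X n k x := by
  apply (β.extCoextendEquiv X (resRing f) n).injective
  simp [extCoextendEquiv_extProj, β.proj_comp_proj_self]

lemma extProj_extShift (k : ℤ) (x : Ext.{w} X (coind f (ModuleCat.of S S)) n) :
    β.extProj X n k (β.extShift X n x) = β.extShift X n (β.extProj X n (k + 1) x) := by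
  simp only [extProj_apply, extShift_apply, Ext.comp_assoc_of_third_deg_zero, Ext.mk₀_comp_mk₀]
  rw [coind_proj_shift]

variable {X' : ModuleCat.{w} A} (e : (ModuleCat.restrictScalars f).obj X ≅ X')

/-- The class is represented by a cocycle on the `n`-th term of the resolution, which lands in
finitely many summands `A tᵏ`. -/
lemma exists_sum_extProj_eq (e : (ModuleCat.restrictScalars f).obj X ≅ X')
    (P : ProjectiveResolution X') (hP : Module.Finite A (P.complex.X n))
    (x : Ext.{w} X (coind f (ModuleCat.of S S)) n) :
    ∃ s : Finset ℤ, ∑ k ∈ s, β.extProj X n k x = x := by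
  obtain ⟨g, hg, h⟩ := P.extMk_surjective
    ((Ext.mk₀ e.inv).comp (β.extCoextendEquiv X (resRing f) n x) (zero_add n)) (n + 1) rfl
  obtain ⟨s, hs⟩ := β.exists_comp_sum_proj g
  refine ⟨s, (β.extCoextendEquiv X (resRing f) n).injective ?_⟩
  have h' := P.extMk_comp_mk₀ g (n + 1) rfl hg (∑ k ∈ s, β.proj k)
  simp only [hs] at h'
  rw [h] at h'
  have h'' := congrArg (fun y => (Ext.mk₀ e.hom).comp y (zero_add n)) h'
  simp only [Ext.comp_assoc_of_third_deg_zero, Ext.mk₀_comp_mk₀_assoc, Iso.hom_inv_id,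
    Ext.mk₀_id_comp] at h''
  rw [map_sum, ← h'', ext_comp_mk₀_sum]
  simp only [extCoextendEquiv_extProj]

/-- The connecting map `Ext_S^n(X, Hom_A(S, S)) → Ext_S^{n+1}(X, S)`. -/
def extDelta (X : ModuleCat.{w} S) (n : ℕ) : Ext.{w} X (coind f (ModuleCat.of S S)) n →+
    Ext.{w} X (ModuleCat.of S S) (n + 1) :=
  ((β.coindSeq_shortExact (ModuleCat.of S S)).extClass).postcomp X rfl

lemma extDelta_apply (x : Ext.{w} X (coind f (ModuleCat.of S S)) n) :
    β.extDelta X n x = x.comp (β.coindSeq_shortExact (ModuleCat.of S S)).extClass rfl := rfl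

lemma ext_comp_shift_sub_id (x : Ext.{w} X (coind f (ModuleCat.of S S)) n) :
    x.comp (Ext.mk₀ ((β.shift (ModuleCat.of S S)).hom - 𝟙 _)) (add_zero n) =
      β.extShift X n x - x := by
  rw [eq_sub_iff_add_eq]
  conv_lhs => enter [2]; rw [← Ext.comp_mk₀_id x]
  rw [← Ext.comp_add, ← Ext.mk₀_add, sub_add_cancel, extShift_apply]

lemma extDelta_extShift (x : Ext.{w} X (coind f (ModuleCat.of S S)) n) :
    β.extDelta X n (β.extShift X n x) = β.extDelta X n x := by
  rw [← sub_eq_zero, ← map_sub, ← ext_comp_shift_sub_id, extDelta_apply,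
    Ext.comp_assoc_of_second_deg_zero,
    ShortComplex.ShortExact.comp_extClass (β.coindSeq_shortExact (ModuleCat.of S S)),
    Ext.comp_zero]

lemma exists_extShift_sub_eq {x : Ext.{w} X (coind f (ModuleCat.of S S)) n}
    (hx : β.extDelta X n x = 0) : ∃ z, β.extShift X n z - z = x := by
  obtain ⟨z, hz⟩ := Ext.covariant_sequence_exact₃ X
    (β.coindSeq_shortExact (ModuleCat.of S S)) x rfl hx
  exact ⟨z, (β.ext_comp_shift_sub_id z).symm.trans hz⟩

lemma exists_extDelta_eq {z : Ext.{w} X (ModuleCat.of S S) (n + 1)}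
    (hz : z.comp (Ext.mk₀ (coind.unit f _)) (add_zero (n + 1)) = 0) :
    ∃ x, β.extDelta X n x = z :=
  Ext.covariant_sequence_exact₁ X (β.coindSeq_shortExact (ModuleCat.of S S)) z hz rfl

/-- Naturality of the coinduced sequence in `S`-linear maps; applied to right multiplications, it
makes `wangHom` linear. -/
lemma extDelta_comp (x : Ext.{w} X (coind f (ModuleCat.of S S)) n)
    (l : ModuleCat.of S S ⟶ ModuleCat.of S S) :
    β.extDelta X n (x.comp (Ext.mk₀ ((ModuleCat.coextendScalars f).map
        ((ModuleCat.restrictScalars f).map l))) (add_zero n)) =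
      (β.extDelta X n x).comp (Ext.mk₀ l) (add_zero (n + 1)) := by
  have h := ShortComplex.ShortExact.extClass_naturality
    (β.coindSeq_shortExact (ModuleCat.of S S)) (β.coindSeq_shortExact (ModuleCat.of S S))
    (β.coindSeqMap l)
  rw [extDelta_apply, extDelta_apply, Ext.comp_assoc_of_third_deg_zero,
    Ext.comp_assoc_of_second_deg_zero]
  exact congrArg (fun z => Ext.comp x z rfl) h.symm

/-- The map `Ext_A^n(X, A) → Ext_S^{n+1}(X, S)` obtained from the sequence
`0 → S → Hom_A(S, S) → Hom_A(S, S) → 0` of `S`-modules. -/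
def wangHom (n : ℕ) : Ext.{w} X' (ModuleCat.of A A) n →+ Ext.{w} X (ModuleCat.of S S) (n + 1) where
  toFun x := β.extDelta X n ((β.extCoextendEquiv X (resRing f) n).symm
    (((Ext.mk₀ e.hom).comp x (zero_add n)).comp (Ext.mk₀ (β.incl 0)) (add_zero n)))
  map_zero' := by simp
  map_add' x y := by simp

lemma wangHom_apply (x : Ext.{w} X' (ModuleCat.of A A) n) :
    β.wangHom e n x = β.extDelta X n ((β.extCoextendEquiv X (resRing f) n).symm
    (((Ext.mk₀ e.hom).comp x (zero_add n)).comp (Ext.mk₀ (β.incl 0)) (add_zero n))) := rfl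

/-- An element of the kernel gives a class of degree `0` of the form `τ z - z`. As `z` has finite
support, `z = 0`. -/
lemma wangHom_injective (P : ProjectiveResolution X') (hP : Module.Finite A (P.complex.X n)) :
    Function.Injective (β.wangHom e n) := by
  rw [injective_iff_map_eq_zero]
  intro x hx
  rw [wangHom_apply] at hx
  set y := ((Ext.mk₀ e.hom).comp x (zero_add n)).comp (Ext.mk₀ (β.incl 0)) (add_zero n) with hy
  obtain ⟨z, hz⟩ := β.exists_extShift_sub_eq hx
  have hy0 : β.extProj X n 0 ((β.extCoextendEquiv X (resRing f) n).symm y) =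
      (β.extCoextendEquiv X (resRing f) n).symm y := by
    rw [extProj_apply, ← extCoextendEquiv_symm_comp, hy, Ext.comp_assoc_of_third_deg_zero,
      Ext.mk₀_comp_mk₀, incl_proj]
  obtain ⟨s, hs⟩ := β.exists_sum_extProj_eq e P hP z
  have hz0 : z = 0 := by
    refine eq_zero_of_shift_sub_homogeneous (π := β.extProj X n) (τ := β.extShift X n)
      (fun k l e h => β.extProj_extProj_of_ne h e) β.extProj_extShift s hs fun k hk => ?_
    rw [hz, ← hy0, β.extProj_extProj_of_ne hk]
  rw [hz0, map_zero, sub_zero, eq_comm, EmbeddingLike.map_eq_zero_iff] at hz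
  -- The coordinate at `t⁰` is a left inverse of `incl 0`, so `x` is recovered from `y`.
  have := congrArg (fun y => (Ext.mk₀ e.inv).comp (y.comp (Ext.mk₀ (β.coord 0)) (add_zero n))
    (zero_add n)) (hy.symm.trans hz)
  simpa [β.incl_coord] using this

lemma wangHom_surjective (P : ProjectiveResolution X') (hP : Module.Finite A (P.complex.X n))
    (hP' : Module.Finite A (P.complex.X (n + 1))) :
    Function.Surjective (β.wangHom e n) := by
  -- A class of degree `0` factors through the summand `A t⁰`, because `proj 0` is `coord 0`
  -- followed by `incl 0`.
  have key : ∀ x, β.extProj X n 0 x = x → ∃ y, β.wangHom e n y = β.extDelta X n x := by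
    intro x hx
    refine ⟨(Ext.mk₀ e.inv).comp ((β.extCoextendEquiv X (resRing f) n x).comp
      (Ext.mk₀ (β.coord 0)) (add_zero n)) (zero_add n), ?_⟩
    rw [wangHom_apply]
    congr 1
    rw [AddEquiv.symm_apply_eq]
    conv_rhs => rw [← hx, extCoextendEquiv_extProj]
    simp [proj]
  intro z
  obtain ⟨s, hs⟩ := β.exists_sum_extProj_eq e P hP'
    (z.comp (Ext.mk₀ (coind.unit f (ModuleCat.of S S))) (add_zero (n + 1)))
  -- The image of `z` is fixed by `τ`, and finite support in degree `n + 1` leaves no nonzero fixed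
  -- class. So `z` lies in the image of the connecting map.
  have hz : z.comp (Ext.mk₀ (coind.unit f (ModuleCat.of S S))) (add_zero (n + 1)) = 0 := by
    refine eq_zero_of_shift_sub_homogeneous (π := β.extProj X (n + 1))
      (τ := β.extShift X (n + 1)) (fun k l e h => β.extProj_extProj_of_ne h e)
      β.extProj_extShift s hs fun k hk => ?_
    rw [extShift_apply, Ext.comp_assoc_of_third_deg_zero, Ext.mk₀_comp_mk₀, unit_shift, sub_self,
      map_zero]
  obtain ⟨x, rfl⟩ := β.exists_extDelta_eq hz
  obtain ⟨s, hs⟩ := β.exists_sum_extProj_eq e P hP x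
  rw [← AddMonoidHom.mem_range, ← hs, map_sum]
  refine sum_mem fun k _ => ?_
  -- Each homogeneous component is moved to degree `0` by a power of `τ`, which does not change its
  -- value under the connecting map.
  obtain ⟨x', hx', h⟩ := exists_degree_zero_of_homogeneous (π := β.extProj X n)
    (τ := β.extShift X n) β.extProj_extShift (β.extDelta X n) β.extDelta_extShift k
    (β.extProj X n k x) (β.extProj_extProj_self k x)
  rw [← h]
  exact key x' hx'

/-- This is why the summand at `t⁰` is used: along `b ↦ b tᵏ`, right multiplication by `f a` on `S`
corresponds to right multiplication by `σᵏ(a)` on `A`. -/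
lemma rightMul_incl_zero (a : A) : rightMul A (MulOpposite.op a) ≫ β.incl 0 =
    β.incl 0 ≫ (ModuleCat.restrictScalars f).map (rightMul S (MulOpposite.op (f a))) := by
  refine ModuleCat.hom_ext <| LinearMap.ext fun b => ?_
  have h : ∀ b : A, f (b * a) * ((β.t ^ (0 : ℤ) : Sˣ) : S) =
      f b * ((β.t ^ (0 : ℤ) : Sˣ) : S) * f a := by simp
  exact (β.incl_apply 0 (b * a)).trans
    ((h b).trans (congrArg (· * f a) (β.incl_apply 0 b)).symm)

lemma wangHom_comp_rightMul (a : A) (x : Ext.{w} X' (ModuleCat.of A A) n) :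
    β.wangHom e n (x.comp (Ext.mk₀ (rightMul A (MulOpposite.op a))) (add_zero n)) =
      (β.wangHom e n x).comp (Ext.mk₀ (rightMul S (MulOpposite.op (f a)))) (add_zero (n + 1)) := by
  have h' : ((Ext.mk₀ e.hom).comp (x.comp (Ext.mk₀ (rightMul A (MulOpposite.op a))) (add_zero n))
      (zero_add n)).comp (Ext.mk₀ (β.incl 0)) (add_zero n) =
      (((Ext.mk₀ e.hom).comp x (zero_add n)).comp (Ext.mk₀ (β.incl 0)) (add_zero n)).comp
        (Ext.mk₀ ((ModuleCat.restrictScalars f).map (rightMul S (MulOpposite.op (f a)))))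
        (add_zero n) := by
    simp only [Ext.comp_assoc_of_third_deg_zero, Ext.mk₀_comp_mk₀, rightMul_incl_zero]
  rw [wangHom_apply, wangHom_apply, h', extCoextendEquiv_symm_comp, extDelta_comp]

end LaurentBasis

end Wang

/-! ### Group rings of extensions of the integers -/

section GroupRing

open MonoidAlgebra

variable (R : Type u) [Ring R] {G : Type v} [Group G]

/-- The inclusion `RK → RG` of group rings, for a subgroup `K` of `G`. -/
abbrev inclusionRingHom (K : Subgroup G) : MonoidAlgebra R K →+* MonoidAlgebra R G :=
  mapDomainRingHom R K.subtype

lemma augmentation_comp_inclusionRingHom (K : Subgroup G) :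
    augmentation R K = (augmentation R G).comp (inclusionRingHom R K) := by
  refine RingHom.coe_addMonoidHom_injective <| addMonoidHom_ext fun k r => ?_
  simp [augmentation, liftNCRingHom]

/-- The restriction of the trivial module to a subgroup is the trivial module. -/
def restrictTrivialModuleIso (K : Subgroup G) :
    (ModuleCat.restrictScalars (inclusionRingHom R K)).obj (trivialModule R G) ≅
      trivialModule R K :=
  (ModuleCat.restrictScalarsComp'App _ _ _ (augmentation_comp_inclusionRingHom R K) _).symm

variable (φ : G →* Multiplicative ℤ) {t : G} (ht : φ t = Multiplicative.ofAdd 1)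

/-- A group element as a unit of the group ring. -/
def unitOf (g : G) : (MonoidAlgebra R G)ˣ := Units.map (of R G) (toUnits g)

lemma unitOf_zpow (g : G) (j : ℤ) :
    ((unitOf R g ^ j : (MonoidAlgebra R G)ˣ) : MonoidAlgebra R G) = single (g ^ j) 1 := by
  rw [unitOf, ← map_zpow, ← map_zpow]
  rfl

/-- This writes `g` as an element of `K` times a power of `t`, so `G` is the disjoint union of the
cosets `K tʲ`; hence the basis of `RG`. -/
lemma mul_zpow_mem_ker (ht : φ t = Multiplicative.ofAdd 1) (g : G) : g * t ^ (-(φ g).toAdd) ∈ φ.ker := by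
  rw [MonoidHom.mem_ker, map_mul, map_zpow, ht, ← ofAdd_zsmul]
  simp

/-- The coordinates of an element of `RG` with respect to the powers of `t`. -/
def laurentCoeff : MonoidAlgebra R G →+ (ℤ →₀ MonoidAlgebra R φ.ker) :=
  (Finsupp.liftAddHom fun g => (Finsupp.singleAddHom (φ g).toAdd).comp
    (singleAddHom ⟨g * t ^ (-(φ g).toAdd), mul_zpow_mem_ker φ ht g⟩)).comp
      coeffAddEquiv.toAddMonoidHom

lemma laurentCoeff_single (g : G) (r : R) : laurentCoeff R φ ht (single g r) =
    Finsupp.single (φ g).toAdd (single ⟨g * t ^ (-(φ g).toAdd), mul_zpow_mem_ker φ ht g⟩ r) := by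
  simp [laurentCoeff]

/-- The linear combinations of the powers of `t` with coefficients in `RK`. -/
def laurentSum (t : G) :
    (ℤ →₀ MonoidAlgebra R φ.ker) →ₗ[MonoidAlgebra R φ.ker] resRing (inclusionRingHom R φ.ker) :=
  Finsupp.linearCombination _ fun j : ℤ => (single (t ^ j) 1 : MonoidAlgebra R G)

/-- `laurentSum` as an additive map to the group ring. -/
def laurentSumAddHom (t : G) : (ℤ →₀ MonoidAlgebra R φ.ker) →+ MonoidAlgebra R G :=
  (laurentSum R φ t).toAddMonoidHom

lemma laurentSumAddHom_single (t : G) (j : ℤ) (a : MonoidAlgebra R φ.ker) :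
    laurentSumAddHom R φ t (Finsupp.single j a) =
      inclusionRingHom R φ.ker a * single (t ^ j) 1 :=
  Finsupp.linearCombination_single (M := resRing (inclusionRingHom R φ.ker)) ..

lemma laurentSumAddHom_single_single (t : G) (j : ℤ) (k : φ.ker) (r : R) :
    laurentSumAddHom R φ t (Finsupp.single j (single k r)) = single (k * t ^ j) r := by
  rw [laurentSumAddHom_single, mapDomainRingHom_apply, mapDomain_single, single_mul_single, mul_one]
  rfl

lemma laurentCoeff_comp_laurentSumAddHom :
    (laurentCoeff R φ ht).comp (laurentSumAddHom R φ t) = AddMonoidHom.id _ := by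
  refine Finsupp.addHom_ext fun j a => ?_
  induction a using MonoidAlgebra.induction_linear with
  | zero => simp
  | add a b ha hb => rw [Finsupp.single_add, map_add, map_add, ha, hb]
  | single k r =>
    have hj : (φ (k * t ^ j)).toAdd = j := by
      rw [map_mul, map_zpow, ht, (MonoidHom.mem_ker).1 k.2, one_mul, ← ofAdd_zsmul]
      simp
    rw [AddMonoidHom.comp_apply, laurentSumAddHom_single_single, laurentCoeff_single,
      AddMonoidHom.id_apply]
    congr 2
    refine Subtype.ext ?_
    change (k : G) * t ^ j * t ^ (-(φ (k * t ^ j)).toAdd) = k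
    rw [hj, zpow_neg, mul_inv_cancel_right]

lemma laurentSumAddHom_comp_laurentCoeff :
    (laurentSumAddHom R φ t).comp (laurentCoeff R φ ht) = AddMonoidHom.id _ := by
  refine addMonoidHom_ext fun g r => ?_
  rw [AddMonoidHom.comp_apply, laurentCoeff_single, laurentSumAddHom_single_single]
  simp

lemma laurentSum_bijective (ht : φ t = Multiplicative.ofAdd 1) : Function.Bijective (laurentSum R φ t) :=
  Function.bijective_iff_has_inverse.2 ⟨laurentCoeff R φ ht,
    DFunLike.congr_fun (laurentCoeff_comp_laurentSumAddHom R φ ht),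
    DFunLike.congr_fun (laurentSumAddHom_comp_laurentCoeff R φ ht)⟩

/-- The twist is conjugation by `t`: `t k = (t k t⁻¹) t`. -/
lemma unitOf_mul_inclusionRingHom (K : Subgroup G) [K.Normal] (t : G) (a : MonoidAlgebra R K) :
    (unitOf R t : MonoidAlgebra R G) * inclusionRingHom R K a =
      inclusionRingHom R K (mapDomainRingEquiv R (MulAut.conjNormal t) a) * unitOf R t := by
  induction a using MonoidAlgebra.induction_linear with
  | zero => simp
  | add a b ha hb => rw [map_add, map_add, map_add, mul_add, add_mul, ha, hb]
  | single k r =>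
    rw [mapDomainRingEquiv_single]
    simp [unitOf, single_mul_single]

/-- The group ring of an extension of `ℤ` is a twisted Laurent polynomial ring over the group ring
of the kernel. -/
def groupRingLaurentBasis : LaurentBasis (inclusionRingHom R φ.ker) where
  t := unitOf R t
  σ := mapDomainRingEquiv R (MulAut.conjNormal t)
  t_mul := unitOf_mul_inclusionRingHom R φ.ker t
  basis := Module.Basis.ofRepr (LinearEquiv.ofBijective _ (laurentSum_bijective R φ ht)).symm
  basis_apply j := by
    rw [unitOf_zpow]
    refine (laurentSumAddHom_single R φ t j 1).trans ?_
    rw [map_one, one_mul]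

/-- The map `H^i(K; RK) → H^{i+1}(G; RG)` of right `RK`-modules. -/
def wangLinearMap (i : ℕ) : cohomologyGroupRing R φ.ker i →ₗ[(MonoidAlgebra R φ.ker)ᵐᵒᵖ]
    restrictRight R φ.ker (cohomologyGroupRing R G (i + 1)) where
  toFun := (groupRingLaurentBasis R φ ht).wangHom (restrictTrivialModuleIso R φ.ker) i
  map_add' := ((groupRingLaurentBasis R φ ht).wangHom (restrictTrivialModuleIso R φ.ker) i).map_add
  map_smul' a := (groupRingLaurentBasis R φ ht).wangHom_comp_rightMul
    (restrictTrivialModuleIso R φ.ker) a.unop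

end GroupRing

end GroupRingCohomology

end

theorem theoremD (R : Type u) [Ring R] (G : Type v) [Group G]
    (φ : G →* Multiplicative ℤ) (hφ : Function.Surjective φ) (n : ℕ∞)
    (hK : GroupRingCohomology.IsOfTypeFP R φ.ker n) :
    (∀ i : ℕ, (i : ℕ∞) < n →
      Nonempty
        (GroupRingCohomology.restrictRight R φ.ker
            (GroupRingCohomology.cohomologyGroupRing R G (i + 1)) ≃ₗ[(MonoidAlgebra R φ.ker)ᵐᵒᵖ]
          GroupRingCohomology.cohomologyGroupRing R φ.ker i)) ∧
    (∀ m : ℕ, (m : ℕ∞) = n →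
      ∃ N : Submodule (MonoidAlgebra R φ.ker)ᵐᵒᵖ
          (GroupRingCohomology.restrictRight R φ.ker
            (GroupRingCohomology.cohomologyGroupRing R G (m + 1))),
        Nonempty
          (GroupRingCohomology.cohomologyGroupRing R φ.ker m ≃ₗ[(MonoidAlgebra R φ.ker)ᵐᵒᵖ]
            N)) := by
  obtain ⟨t, ht⟩ := hφ (Multiplicative.ofAdd 1)
  obtain ⟨P, hP⟩ := hK
  have hinj : ∀ i : ℕ, (i : ℕ∞) ≤ n →
      Function.Injective (GroupRingCohomology.wangLinearMap R φ ht i) := fun i hi =>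
    (GroupRingCohomology.groupRingLaurentBasis R φ ht).wangHom_injective _ P (hP i hi)
  refine ⟨fun i hi => ?_, fun m hm => ?_⟩
  -- From `i < n` follows `i + 1 ≤ n`, so the terms in degrees `i` and `i + 1` are both finitely
  -- generated.
  · exact ⟨(LinearEquiv.ofBijective (GroupRingCohomology.wangLinearMap R φ ht i)
      ⟨hinj i hi.le, (GroupRingCohomology.groupRingLaurentBasis R φ ht).wangHom_surjective _ P
        (hP i hi.le) (hP (i + 1) (by exact_mod_cast Order.add_one_le_of_lt hi))⟩).symm⟩
  · exact ⟨_, ⟨LinearEquiv.ofInjective (GroupRingCohomology.wangLinearMap R φ ht m)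
      (hinj m hm.le)⟩⟩
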